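/- Consider two sets of terms, both taken up to $\alpha$-equivalence. (i) Terms with generalized applications, $t,u,r ::= x \mid \lambda x.t \mid t(u,y.r)$, where $y$ is bound in $r$. We write $S$ for a generalized argument $(u,y.r)$, so that $tS = t(u,y.r)$, and $t\vec S = tS_1\cdots S_n$ ($n\ge 0$, associated to the left); $\{u/x\}t$ is capture-avoiding substitution. The relation $\to_{\beta,\pi}$ is the closure under all term constructors of $$(\lambda x.t)(u,y.r)\mapsto_\beta \{\{u/x\}t/y\}r,\qquad t(u,x.r)\,S\mapsto_\pi t(u,x.\,rS)\quad (x\notin \mathrm{fv}(S)),$$ and $SN(\beta,\pi)$ is the set of terms from which no infinite $\to_{\beta,\pi}$-sequence starts. The set $ISN(\beta,\pi)$ is the least set of terms such that: - (var) $x\in ISN(\beta,\pi)$; - (lambda) if $t\in ISN(\beta,\pi)$ then $\lambda x.t\in ISN(\beta,\pi)$; - (hvar) if $u,r\in ISN(\beta,\pi)$ then $x(u,y.r)\in ISN(\beta,\pi)$; - (pi) if $x(u,y.\,rS)\vec S\in ISN(\beta,\pi)$, with $y\notin\mathrm{fv}(S)$, then $x(u,y.r)S\vec S\in ISN(\beta,\pi)$;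 - (beta) if $\{\{u/x\}t/y\}r\,\vec S,\ t,\ u\in ISN(\beta,\pi)$ then $(\lambda x.t)(u,y.r)\vec S\in ISN(\beta,\pi)$. (ii) Terms with explicit substitutions, $M,N ::= x\mid \lambda x.M\mid MN\mid [N/x]M$, where $x$ is bound in $M$ in $[N/x]M$. List contexts are $L ::= \Diamond\mid [N/x]L$. Reduction is the closure under all term constructors of $$L\langle\lambda x.M\rangle N\mapsto_{\mathrm{dB}} L\langle [N/x]M\rangle,\qquad [N/x]M\mapsto_{\mathrm{sub}}\{N/x\}M,$$ where in the first rule $L$ binds no free variable of $N$; $SN(ES)$ is the set of strongly normalizing terms for this reduction. Define translations $t\mapsto t^{*}$ from (i) to (ii) and $M\mapsto M^{\circ}$ from (ii) to (i) by $$x^*=x,\quad (\lambda x.t)^*=\lambda x.t^*,\quad t(u,x.r)^*=[t^*/x^l][u^*/x^r]\{x^lx^r/x\}r^*\ \ (x^l,x^r\text{ fresh}),$$ $$x^\circ=x,\quad (\lambda x.M)^\circ=\lambda x.M^\circ,\quad (MN)^\circ=M^\circ(N^\circ,z.z),\quad ([N/x]M)^\circ=(\lambda z.z)(N^\circ,x.M^\circ).$$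 Then: 1. for every term $t$ with generalized applications, if $t\in SN(\beta,\pi)$ then $(t^{*})^{\circ}\in ISN(\beta,\pi)$; 2. the translation $t\mapsto t^*$ is faithful: for every term $t$ with generalized applications, $t\in SN(\beta,\pi)$ if and only if $t^*\in SN(ES)$. -/

import Mathlib

/-!
Terms are taken up to alpha-equivalence, represented by de Bruijn indices: in `lam t`, in
`gapp t u r` and in `esub M N`, index `0` of `t`, of `r` and of `M`, respectively, is bound.
-/

/-- Extension of a renaming under one binder. -/
def upRen (ρ : ℕ → ℕ) : ℕ → ℕ
  | 0 => 0
  | n + 1 => ρ n + 1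

/-- `t` is strongly normalizing for `R`: there is no infinite `R`-reduction sequence from `t`
(in the form of accessibility for the converse of `R`). -/
def StronglyNormalizing {α : Type} (R : α → α → Prop) (t : α) : Prop :=
  Acc (fun b a => R a b) t

/-! ### The calculus with generalized applications -/

/-- Terms with generalized applications, `t, u, r ::= x | λ x. t | t(u, y. r)`. -/
inductive JTerm : Type
  | var (x : ℕ) : JTerm
  | lam (t : JTerm) : JTerm
  | gapp (t u r : JTerm) : JTerm

namespace JTerm

/-- Renaming of free variables. -/
def rename : (ℕ → ℕ) → JTerm → JTerm
  | ρ, var x => var (ρ x)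
  | ρ, lam t => lam (rename (upRen ρ) t)
  | ρ, gapp t u r => gapp (rename ρ t) (rename ρ u) (rename (upRen ρ) r)

/-- Weakening: the same term in a scope with one more (innermost) bound variable. -/
def shift (t : JTerm) : JTerm := rename Nat.succ t

/-- Extension of a substitution under one binder. -/
def up (σ : ℕ → JTerm) : ℕ → JTerm
  | 0 => var 0
  | n + 1 => shift (σ n)

/-- Simultaneous capture-avoiding substitution. -/
def subst : (ℕ → JTerm) → JTerm → JTerm
  | σ, var x => σ x
  | σ, lam t => lam (subst (up σ) t)
  | σ, gapp t u r => gapp (subst σ t) (subst σ u) (subst (up σ) r)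

/-- The substitution that replaces index `0` by `u` and leaves the surrounding scope. -/
def single (u : JTerm) : ℕ → JTerm
  | 0 => u
  | n + 1 => var n

/-- `inst t u` is `{u/x} t`, where `x` is the variable with index `0` in `t`. -/
def inst (t u : JTerm) : JTerm := subst (single u) t

/-- The generalized argument `S = (u, y. r)` applied to a term: `t S = t(u, y. r)`. -/
def appArg (t : JTerm) (S : JTerm × JTerm) : JTerm := gapp t S.1 S.2

/-- `t S₁ … Sₙ`, associated to the left. -/
def appArgs (t : JTerm) (Ss : List (JTerm × JTerm)) : JTerm := Ss.foldl appArg t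

/-- Weakening of a generalized argument `(u, y. r)`. -/
def shiftArg (S : JTerm × JTerm) : JTerm × JTerm := (shift S.1, rename (upRen Nat.succ) S.2)

/-- One-step reduction `→_{β,π}`: the closure under all term constructors of
* `β`: `(λ x. t)(u, y. r) ↦ {{u/x} t / y} r`,
* `π`: `t(u, x. r) S ↦ t(u, x. r S)`, with `x` not free in `S`. -/
inductive Step : JTerm → JTerm → Prop
  | beta (t u r : JTerm) : Step (gapp (lam t) u r) (inst r (inst t u))
  | pi (t u r : JTerm) (S : JTerm × JTerm) :
      Step (appArg (gapp t u r) S) (gapp t u (appArg r (shiftArg S)))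
  | lam {t t' : JTerm} : Step t t' → Step (lam t) (lam t')
  | gapp₁ {t t' : JTerm} (u r : JTerm) : Step t t' → Step (gapp t u r) (gapp t' u r)
  | gapp₂ (t : JTerm) {u u' : JTerm} (r : JTerm) : Step u u' → Step (gapp t u r) (gapp t u' r)
  | gapp₃ (t u : JTerm) {r r' : JTerm} : Step r r' → Step (gapp t u r) (gapp t u r')

/-- `t ∈ SN(β,π)`. -/
def SN (t : JTerm) : Prop := StronglyNormalizing Step t

/-- The inductive predicate `ISN(β,π)`. -/
inductive ISN : JTerm → Prop
  | var (x : ℕ) : ISN (var x)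
  | hvar (x : ℕ) {u r : JTerm} : ISN u → ISN r → ISN (gapp (var x) u r)
  | lam {t : JTerm} : ISN t → ISN (lam t)
  | pi (x : ℕ) (u r : JTerm) (S : JTerm × JTerm) (Ss : List (JTerm × JTerm)) :
      ISN (appArgs (gapp (var x) u (appArg r (shiftArg S))) Ss) →
      ISN (appArgs (appArg (gapp (var x) u r) S) Ss)
  | beta (t u r : JTerm) (Ss : List (JTerm × JTerm)) :
      ISN (appArgs (inst r (inst t u)) Ss) → ISN t → ISN u →
      ISN (appArgs (gapp (lam t) u r) Ss)

end JTerm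

/-! ### The calculus with explicit substitutions -/

/-- Terms with explicit substitutions, `M, N ::= x | λ x. M | M N | [N/x] M`;
`esub M N` is `[N/x] M`. -/
inductive ESTerm : Type
  | var (x : ℕ) : ESTerm
  | lam (M : ESTerm) : ESTerm
  | app (M N : ESTerm) : ESTerm
  | esub (M N : ESTerm) : ESTerm

namespace ESTerm

/-- Renaming of free variables. -/
def rename : (ℕ → ℕ) → ESTerm → ESTerm
  | ρ, var x => var (ρ x)
  | ρ, lam M => lam (rename (upRen ρ) M)
  | ρ, app M N => app (rename ρ M) (rename ρ N)
  | ρ, esub M N => esub (rename (upRen ρ) M) (rename ρ N)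

/-- Weakening: the same term in a scope with one more (innermost) bound variable. -/
def shift (M : ESTerm) : ESTerm := rename Nat.succ M

/-- Extension of a substitution under one binder. -/
def up (σ : ℕ → ESTerm) : ℕ → ESTerm
  | 0 => var 0
  | n + 1 => shift (σ n)

/-- Simultaneous capture-avoiding (meta-level) substitution. -/
def subst : (ℕ → ESTerm) → ESTerm → ESTerm
  | σ, var x => σ x
  | σ, lam M => lam (subst (up σ) M)
  | σ, app M N => app (subst σ M) (subst σ N)
  | σ, esub M N => esub (subst (up σ) M) (subst σ N)

/-- The substitution that replaces index `0` by `N` and leaves the surrounding scope. -/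
def single (N : ESTerm) : ℕ → ESTerm
  | 0 => N
  | n + 1 => var n

/-- `inst M N` is the meta-level `{N/x} M`, where `x` is the variable with index `0` in `M`. -/
def inst (M N : ESTerm) : ESTerm := subst (single N) M

/-- `plug [P₁, …, Pₖ] M` is the term `L⟨M⟩ = [P₁/x₁] … [Pₖ/xₖ] M` for the list context
`L = [P₁/x₁] … [Pₖ/xₖ] ◇`, which binds `k` variables in `M`. -/
def plug : List ESTerm → ESTerm → ESTerm
  | [], M => M
  | P :: L, M => esub (plug L M) P

/-- One-step reduction of the calculus with explicit substitutions: the closure under all term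
constructors of
* `dB` (beta at a distance): `L⟨λ x. M⟩ N ↦ L⟨[N/x] M⟩`, with no variable bound by `L` free
  in `N`,
* `sub`: `[N/x] M ↦ {N/x} M`. -/
inductive Step : ESTerm → ESTerm → Prop
  | dB (L : List ESTerm) (M N : ESTerm) :
      Step (app (plug L (lam M)) N) (plug L (esub M (rename (fun n => n + L.length) N)))
  | sub (M N : ESTerm) : Step (esub M N) (inst M N)
  | lam {M M' : ESTerm} : Step M M' → Step (lam M) (lam M')
  | app₁ {M M' : ESTerm} (N : ESTerm) : Step M M' → Step (app M N) (app M' N)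
  | app₂ (M : ESTerm) {N N' : ESTerm} : Step N N' → Step (app M N) (app M N')
  | esub₁ {M M' : ESTerm} (N : ESTerm) : Step M M' → Step (esub M N) (esub M' N)
  | esub₂ (M : ESTerm) {N N' : ESTerm} : Step N N' → Step (esub M N) (esub M N')

/-- Strong normalization in the calculus with explicit substitutions. -/
def SN (M : ESTerm) : Prop := StronglyNormalizing Step M

/-- The substitution `{xˡ xʳ / x}`, from a scope whose last variable is `x` to a scope where `x`
is replaced by `xˡ` (index `1`) followed by `xʳ` (index `0`). -/
def splitVar : ℕ → ESTerm
  | 0 => app (var 1) (var 0)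
  | n + 1 => var (n + 2)

end ESTerm

/-! ### The translations -/

/-- The translation into explicit substitutions: variables and abstractions are preserved and
`t(u, x. r)` becomes `[t*/xˡ] [u*/xʳ] {xˡ xʳ / x} r*` with fresh `xˡ`, `xʳ`. -/
def JTerm.toES : JTerm → ESTerm
  | var x => .var x
  | lam t => .lam t.toES
  | gapp t u r => .esub (.esub (.subst ESTerm.splitVar r.toES) u.toES.shift) t.toES

/-- The translation back: variables and abstractions are preserved, `M N` becomes `M°(N°, z. z)`
and `[N/x] M` becomes `I(N°, x. M°)`, where `I = λ z. z`. -/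
def ESTerm.toJ : ESTerm → JTerm
  | var x => .var x
  | lam M => .lam M.toJ
  | app M N => .gapp M.toJ N.toJ (.var 0)
  | esub M N => .gapp (.lam (.var 0)) N.toJ M.toJ

/-- The composite translation of terms with generalized applications, through explicit
substitutions and back. -/
def JTerm.toJJ (t : JTerm) : JTerm := t.toES.toJ

/-! ### Generalities -/

/-! Both claims reduce to three implications: `t ∈ SN(β,π)` gives `t*° ∈ SN(β,π)` (`JTerm.SN.toJJ`);
`M° ∈ SN(β,π)` gives `M ∈ SN(ES)` (`ESTerm.SN.of_toJ`); and `t* ∈ SN(ES)` gives `t ∈ SN(β,π)`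
(`ESTerm.SN.of_subst_toES`). The inductive predicate is reached only at the end, by `JTerm.SN.isn`.

None of these is a step-by-step simulation: π permutes the explicit substitutions of `t*`, which no
rule of ES does, and `°` sends both sides of a dB step to β-redexes with the same contractum.
Instead, each argument is an induction on a strongly normalizing term along reduction and passage to
subterms together. A term is decomposed at its head, the induction hypothesis gives strong
normalization of the contracted head redex and of the parts it might erase, and a head expansion
lemma returns to the term itself (`HeadBeta.sn`, `HeadPi.sn`, `HeadSub.sn`, `HeadB.sn`).

The hardest implication is the first. The term `t(u,x.r)*°` is a nest of two identity redexes that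
β-reduces to `{t*°(u*°,z.z)/x} r*°`, so head expansions occur inside a substitution, possibly in
many copies. `SN.subst_of_headExpands` shows that strong normalization survives replacing the
substituted terms by head expansions of them. A case analysis on `t` then matches the three forms of
the substituted term with a variable, a β-step and a π-step. -/

theorem upRen_comp (ρ ρ' : ℕ → ℕ) (n : ℕ) : upRen ρ' (upRen ρ n) = upRen (ρ' ∘ ρ) n := by
  cases n <;> rfl

/-- If reduction commutes with a well-founded subterm relation, then every strongly normalizing
term is accessible for the union of reduction and the subterm relation. -/
theorem StronglyNormalizing.acc_union {α : Type} {R S : α → α → Prop} (hS : WellFounded S)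
    (comm : ∀ s t s', S s t → R s s' → ∃ t', R t t' ∧ S s' t') {t : α}
    (h : StronglyNormalizing R t) : Acc (fun b a => R a b ∨ S b a) t := by
  have comm' : ∀ s t, Relation.ReflTransGen S s t → ∀ s', R s s' →
      ∃ t', R t t' ∧ Relation.ReflTransGen S s' t' := by
    intro s t hst
    induction hst with
    | refl => exact fun s' h => ⟨s', h, .refl⟩
    | tail _ h₂ ih =>
      intro s' hs
      obtain ⟨t', ht, hs't'⟩ := ih s' hs
      obtain ⟨t'', ht', h'⟩ := comm _ _ _ h₂ ht
      exact ⟨t'', ht', hs't'.tail h'⟩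
  have key : ∀ s, Relation.ReflTransGen S s t → Acc (fun b a => R a b ∨ S b a) s := by
    induction h with
    | intro t _ ih =>
      intro s
      induction s using hS.induction with
      | _ s ihs =>
        intro hst
        refine ⟨_, ?_⟩
        rintro s' (hs | hs)
        · obtain ⟨t', ht, hs't'⟩ := comm' s t hst s' hs
          exact ih t' ht s' hs't'
        · exact ihs s' hs (Relation.ReflTransGen.head hs hst)
  exact key t .refl

theorem StronglyNormalizing.step {α : Type} {R : α → α → Prop} {a b : α}
    (h : StronglyNormalizing R a) (hab : R a b) : StronglyNormalizing R b :=
  Acc.inv h hab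

theorem StronglyNormalizing.steps {α : Type} {R : α → α → Prop} {a b : α}
    (h : StronglyNormalizing R a) (hab : Relation.ReflTransGen R a b) :
    StronglyNormalizing R b := by
  induction hab with
  | refl => exact h
  | tail _ h₂ ih => exact ih.step h₂

/-- Strong normalization is reflected by maps that preserve reduction. -/
theorem StronglyNormalizing.of_map {α β : Type} {R : α → α → Prop} {R' : β → β → Prop}
    (f : α → β) (hf : ∀ a b, R a b → R' (f a) (f b)) {a : α}
    (h : StronglyNormalizing R' (f a)) : StronglyNormalizing R a := by
  generalize hc : f a = c at h
  induction h generalizing a with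
  | intro c _ ih =>
    subst hc
    exact ⟨_, fun b hab => ih (f b) (hf a b hab) rfl⟩

/-- The converse of reduction in at least one step is well founded below a strongly normalizing
term. -/
theorem StronglyNormalizing.transGen {α : Type} {R : α → α → Prop} {a : α}
    (h : StronglyNormalizing R a) : Acc (fun b a => Relation.TransGen R a b) a := by
  have := Acc.transGen h
  refine Subrelation.accessible ?_ this
  intro x y hxy
  exact Relation.transGen_swap.mp hxy

/-! ### Renaming and substitution in terms with generalized applications -/

namespace JTerm

theorem rename_rename (ρ ρ' : ℕ → ℕ) (t : JTerm) :
    rename ρ' (rename ρ t) = rename (ρ' ∘ ρ) t := by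
  induction t generalizing ρ ρ' with
  | var x => rfl
  | lam t ih => simp only [rename, ih, lam.injEq]; congr 1; funext n; exact upRen_comp _ _ _
  | gapp t u r iht ihu ihr =>
    simp only [rename, iht, ihu, ihr, gapp.injEq, true_and]
    congr 1; funext n; exact upRen_comp _ _ _

theorem subst_rename (ρ : ℕ → ℕ) (σ : ℕ → JTerm) (t : JTerm) :
    subst σ (rename ρ t) = subst (σ ∘ ρ) t := by
  have h (σ : ℕ → JTerm) (ρ : ℕ → ℕ) : up σ ∘ upRen ρ = up (σ ∘ ρ) := by
    funext n; cases n <;> rfl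
  induction t generalizing ρ σ with
  | var x => rfl
  | lam t ih => simp only [rename, subst, ih, h]
  | gapp t u r iht ihu ihr => simp only [rename, subst, iht, ihu, ihr, h]

theorem rename_subst (ρ : ℕ → ℕ) (σ : ℕ → JTerm) (t : JTerm) :
    rename ρ (subst σ t) = subst (fun x => rename ρ (σ x)) t := by
  have h (σ : ℕ → JTerm) (ρ : ℕ → ℕ) :
      (fun x => rename (upRen ρ) (up σ x)) = up (fun x => rename ρ (σ x)) := by
    funext n; cases n
    · rfl
    · simp only [up, shift, rename_rename]; rfl
  induction t generalizing ρ σ with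
  | var x => rfl
  | lam t ih => simp only [rename, subst, ih, h]
  | gapp t u r iht ihu ihr => simp only [rename, subst, iht, ihu, ihr, h]

theorem subst_subst (σ τ : ℕ → JTerm) (t : JTerm) :
    subst τ (subst σ t) = subst (fun x => subst τ (σ x)) t := by
  have h (σ τ : ℕ → JTerm) :
      (fun x => subst (up τ) (up σ x)) = up (fun x => subst τ (σ x)) := by
    funext n; cases n
    · rfl
    · simp only [up, shift, rename_subst, subst_rename]; rfl
  induction t generalizing σ τ with
  | var x => rfl
  | lam t ih => simp only [subst, ih, h]
  | gapp t u r iht ihu ihr => simp only [subst, iht, ihu, ihr, h]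

theorem subst_var (t : JTerm) : subst var t = t := by
  have h : up var = var := by funext n; cases n <;> rfl
  induction t with
  | var x => rfl
  | lam t ih => simp only [subst, h, ih]
  | gapp t u r iht ihu ihr => simp only [subst, h, iht, ihu, ihr]

theorem rename_eq_subst (ρ : ℕ → ℕ) (t : JTerm) : rename ρ t = subst (var ∘ ρ) t := by
  rw [← subst_rename, subst_var]

theorem rename_id (t : JTerm) : rename id t = t := by
  rw [rename_eq_subst]; exact subst_var t

theorem inst_shift (t u : JTerm) : inst (shift t) u = t := by
  rw [inst, shift, subst_rename]; exact subst_var t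

theorem subst_up_shift (σ : ℕ → JTerm) (t : JTerm) :
    subst (up σ) (shift t) = shift (subst σ t) := by
  simp only [shift, subst_rename, rename_subst]; rfl

theorem subst_up_up_rename (σ : ℕ → JTerm) (t : JTerm) :
    subst (up (up σ)) (rename (upRen Nat.succ) t) = rename (upRen Nat.succ) (subst (up σ) t) := by
  simp only [subst_rename, rename_subst]
  congr 1; funext n; cases n
  · rfl
  · simp only [Function.comp, upRen, up, shift, rename_rename]; rfl

theorem subst_inst (σ : ℕ → JTerm) (t u : JTerm) :
    subst σ (inst t u) = inst (subst (up σ) t) (subst σ u) := by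
  simp only [inst, subst_subst]
  congr 1; funext n; cases n
  · rfl
  · exact (inst_shift _ _).symm

theorem rename_inst (ρ : ℕ → ℕ) (t u : JTerm) :
    rename ρ (inst t u) = inst (rename (upRen ρ) t) (rename ρ u) := by
  simp only [inst, rename_subst, subst_rename]
  congr 1; funext n; cases n <;> rfl

/-- Substitution in a generalized argument. -/
def substArg (σ : ℕ → JTerm) (S : JTerm × JTerm) : JTerm × JTerm :=
  (subst σ S.1, subst (up σ) S.2)

theorem subst_appArgs (σ : ℕ → JTerm) (t : JTerm) (Ss : List (JTerm × JTerm)) :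
    subst σ (appArgs t Ss) = appArgs (subst σ t) (Ss.map (substArg σ)) := by
  induction Ss generalizing t with
  | nil => rfl
  | cons S Ss ih => exact ih (appArg t S)

theorem shiftArg_eq (S : JTerm × JTerm) : shiftArg S = substArg (fun n => var (n + 1)) S := by
  simp only [shiftArg, substArg, shift, rename_eq_subst]
  congr 2; funext n; cases n <;> rfl

theorem substArg_substArg (σ τ : ℕ → JTerm) (S : JTerm × JTerm) :
    substArg τ (substArg σ S) = substArg (fun x => subst τ (σ x)) S := by
  simp only [substArg, subst_subst]
  congr 2; funext n; cases n
  · rfl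
  · exact (subst_up_shift τ (σ _))

theorem substArg_var (S : JTerm × JTerm) : substArg var S = S := by
  have h : up var = var := by funext n; cases n <;> rfl
  simp only [substArg, h, subst_var]

end JTerm

/-! ### Renaming and substitution in terms with explicit substitutions -/

namespace ESTerm

theorem rename_rename (ρ ρ' : ℕ → ℕ) (t : ESTerm) :
    rename ρ' (rename ρ t) = rename (ρ' ∘ ρ) t := by
  have h (ρ ρ' : ℕ → ℕ) : upRen ρ' ∘ upRen ρ = upRen (ρ' ∘ ρ) := funext (upRen_comp ρ ρ')
  induction t generalizing ρ ρ' with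
  | var x => rfl
  | lam t ih => simp only [rename, ih, h]
  | app M N ihM ihN => simp only [rename, ihM, ihN]
  | esub M N ihM ihN => simp only [rename, ihM, ihN, h]

theorem subst_rename (ρ : ℕ → ℕ) (σ : ℕ → ESTerm) (t : ESTerm) :
    subst σ (rename ρ t) = subst (σ ∘ ρ) t := by
  have h (σ : ℕ → ESTerm) (ρ : ℕ → ℕ) : up σ ∘ upRen ρ = up (σ ∘ ρ) := by
    funext n; cases n <;> rfl
  induction t generalizing ρ σ with
  | var x => rfl
  | lam t ih => simp only [rename, subst, ih, h]
  | app M N ihM ihN => simp only [rename, subst, ihM, ihN]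
  | esub M N ihM ihN => simp only [rename, subst, ihM, ihN, h]

theorem rename_subst (ρ : ℕ → ℕ) (σ : ℕ → ESTerm) (t : ESTerm) :
    rename ρ (subst σ t) = subst (fun x => rename ρ (σ x)) t := by
  have h (σ : ℕ → ESTerm) (ρ : ℕ → ℕ) :
      (fun x => rename (upRen ρ) (up σ x)) = up (fun x => rename ρ (σ x)) := by
    funext n; cases n
    · rfl
    · simp only [up, shift, rename_rename]; rfl
  induction t generalizing ρ σ with
  | var x => rfl
  | lam t ih => simp only [rename, subst, ih, h]
  | app M N ihM ihN => simp only [rename, subst, ihM, ihN]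
  | esub M N ihM ihN => simp only [rename, subst, ihM, ihN, h]

theorem subst_subst (σ τ : ℕ → ESTerm) (t : ESTerm) :
    subst τ (subst σ t) = subst (fun x => subst τ (σ x)) t := by
  have h (σ τ : ℕ → ESTerm) :
      (fun x => subst (up τ) (up σ x)) = up (fun x => subst τ (σ x)) := by
    funext n; cases n
    · rfl
    · simp only [up, shift, rename_subst, subst_rename]; rfl
  induction t generalizing σ τ with
  | var x => rfl
  | lam t ih => simp only [subst, ih, h]
  | app M N ihM ihN => simp only [subst, ihM, ihN]
  | esub M N ihM ihN => simp only [subst, ihM, ihN, h]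

theorem subst_var (t : ESTerm) : subst var t = t := by
  have h : up var = var := by funext n; cases n <;> rfl
  induction t with
  | var x => rfl
  | lam t ih => simp only [subst, h, ih]
  | app M N ihM ihN => simp only [subst, ihM, ihN]
  | esub M N ihM ihN => simp only [subst, h, ihM, ihN]

theorem rename_eq_subst (ρ : ℕ → ℕ) (t : ESTerm) : rename ρ t = subst (var ∘ ρ) t := by
  rw [← subst_rename, subst_var]

theorem rename_id (t : ESTerm) : rename (fun n => n) t = t := by
  rw [rename_eq_subst]; exact subst_var t

theorem inst_shift (t u : ESTerm) : inst (shift t) u = t := by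
  rw [inst, shift, subst_rename]; exact subst_var t

theorem subst_up_shift (σ : ℕ → ESTerm) (t : ESTerm) :
    subst (up σ) (shift t) = shift (subst σ t) := by
  simp only [shift, subst_rename, rename_subst]; rfl

theorem subst_inst (σ : ℕ → ESTerm) (t u : ESTerm) :
    subst σ (inst t u) = inst (subst (up σ) t) (subst σ u) := by
  simp only [inst, subst_subst]
  congr 1; funext n; cases n
  · rfl
  · exact (inst_shift _ _).symm

end ESTerm

/-! ### Translations commute with renaming and substitution -/

namespace JTerm

theorem toES_rename (ρ : ℕ → ℕ) (t : JTerm) : (rename ρ t).toES = ESTerm.rename ρ t.toES := by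
  induction t generalizing ρ with
  | var x => rfl
  | lam t ih => simp only [rename, toES, ESTerm.rename, ih]
  | gapp t u r iht ihu ihr =>
    simp only [rename, toES, ESTerm.rename, iht, ihu, ihr, ESTerm.shift, ESTerm.rename_rename,
      ESTerm.rename_subst, ESTerm.subst_rename]
    congr 3
    funext n; cases n <;> rfl

theorem splitVar_subst_up (σ : ℕ → ESTerm) (M : ESTerm) :
    ESTerm.subst (ESTerm.up (ESTerm.up σ)) (ESTerm.subst ESTerm.splitVar M) =
      ESTerm.subst ESTerm.splitVar (ESTerm.subst (ESTerm.up σ) M) := by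
  simp only [ESTerm.subst_subst]
  congr 1; funext n; cases n
  · rfl
  · change ESTerm.shift (ESTerm.shift _) = ESTerm.subst ESTerm.splitVar (ESTerm.shift _)
    simp only [ESTerm.shift, ESTerm.subst_rename, ESTerm.rename_rename]
    exact ESTerm.rename_eq_subst _ _

theorem toES_subst (σ : ℕ → JTerm) (t : JTerm) :
    (subst σ t).toES = ESTerm.subst (fun x => (σ x).toES) t.toES := by
  have h (σ : ℕ → JTerm) : (fun x => (up σ x).toES) = ESTerm.up (fun x => (σ x).toES) := by
    funext n; cases n
    · rfl
    · exact toES_rename _ _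
  induction t generalizing σ with
  | var x => rfl
  | lam t ih => simp only [subst, toES, ESTerm.subst, ih, h]
  | gapp t u r iht ihu ihr =>
    simp only [subst, toES, ESTerm.subst, iht, ihu, ihr, h, splitVar_subst_up,
      ESTerm.subst_up_shift]

theorem toES_inst (t u : JTerm) : (inst t u).toES = ESTerm.inst t.toES u.toES := by
  rw [inst, toES_subst, ESTerm.inst]
  congr 1; funext n; cases n <;> rfl

end JTerm

namespace ESTerm

theorem toJ_rename (ρ : ℕ → ℕ) (M : ESTerm) : (rename ρ M).toJ = JTerm.rename ρ M.toJ := by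
  induction M generalizing ρ with
  | var x => rfl
  | lam M ih => simp only [rename, toJ, JTerm.rename, ih]
  | app M N ihM ihN => simp only [rename, toJ, JTerm.rename, ihM, ihN, upRen]
  | esub M N ihM ihN => simp only [rename, toJ, JTerm.rename, ihM, ihN, upRen]

theorem toJ_subst (σ : ℕ → ESTerm) (M : ESTerm) :
    (subst σ M).toJ = JTerm.subst (fun x => (σ x).toJ) M.toJ := by
  have h (σ : ℕ → ESTerm) : (fun x => (up σ x).toJ) = JTerm.up (fun x => (σ x).toJ) := by
    funext n; cases n
    · rfl
    · exact toJ_rename _ _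
  induction M generalizing σ with
  | var x => rfl
  | lam M ih => simp only [subst, toJ, JTerm.subst, ih, h]
  | app M N ihM ihN => simp only [subst, toJ, JTerm.subst, ihM, ihN, JTerm.up]
  | esub M N ihM ihN => simp only [subst, toJ, JTerm.subst, ihM, ihN, h, JTerm.up]

theorem toJ_inst (M N : ESTerm) : (inst M N).toJ = JTerm.inst M.toJ N.toJ := by
  rw [inst, toJ_subst, JTerm.inst]
  congr 1; funext n; cases n <;> rfl

end ESTerm

namespace JTerm

theorem toJJ_inst (t u : JTerm) : (inst t u).toJJ = inst t.toJJ u.toJJ := by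
  rw [toJJ, toES_inst, ESTerm.toJ_inst]; rfl

/-- The identity `λ z. z`. -/
def idTerm : JTerm := lam (var 0)

/-- The substitution `{xˡ(xʳ, z. z) / x}`, with `xˡ` of index `1` and `xʳ` of index `0`. -/
def splitArg : ℕ → JTerm
  | 0 => gapp (var 1) (var 0) (var 0)
  | n + 1 => var (n + 2)

/-- Both explicit substitutions become redexes headed by the identity, so π and β act on the image
as on any other term. -/
theorem toJJ_gapp (t u r : JTerm) : (gapp t u r).toJJ =
    gapp idTerm t.toJJ (gapp idTerm (shift u.toJJ) (subst splitArg r.toJJ)) := by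
  simp only [toJJ, toES, ESTerm.toJ, ESTerm.toJ_subst, ESTerm.shift, ESTerm.toJ_rename]
  have : (fun x => (ESTerm.splitVar x).toJ) = splitArg := by funext n; cases n <;> rfl
  rw [this]; rfl

end JTerm

/-! ### Reduction of terms with generalized applications -/

namespace JTerm

theorem Step.subst {t t' : JTerm} (h : Step t t') (σ : ℕ → JTerm) :
    Step (JTerm.subst σ t) (JTerm.subst σ t') := by
  induction h generalizing σ with
  | beta t u r =>
    rw [subst_inst, subst_inst]
    exact .beta _ _ _
  | pi t u r S =>
    have := Step.pi (JTerm.subst σ t) (JTerm.subst σ u) (JTerm.subst (up σ) r) (substArg σ S)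
    simpa only [appArg, JTerm.subst, shiftArg, substArg, subst_up_shift, subst_up_up_rename]
      using this
  | lam _ ih => exact .lam (ih _)
  | gapp₁ u r _ ih => exact .gapp₁ _ _ (ih _)
  | gapp₂ t r _ ih => exact .gapp₂ _ _ (ih _)
  | gapp₃ t u _ ih => exact .gapp₃ _ _ (ih _)

theorem Step.rename {t t' : JTerm} (h : Step t t') (ρ : ℕ → ℕ) :
    Step (JTerm.rename ρ t) (JTerm.rename ρ t') := by
  rw [rename_eq_subst, rename_eq_subst]; exact h.subst _

/-- Reduction in any number of steps. -/
abbrev Steps : JTerm → JTerm → Prop := Relation.ReflTransGen Step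

theorem Steps.lam {t t' : JTerm} (h : Steps t t') : Steps (lam t) (lam t') :=
  h.lift _ fun _ _ => .lam

theorem Steps.gapp {t t' u u' r r' : JTerm} (ht : Steps t t') (hu : Steps u u')
    (hr : Steps r r') : Steps (gapp t u r) (gapp t' u' r') :=
  ((ht.lift (fun t => JTerm.gapp t u r) fun _ _ => .gapp₁ _ _).trans
    (hu.lift (fun u => JTerm.gapp t' u r) fun _ _ => .gapp₂ _ _)).trans
    (hr.lift (fun r => JTerm.gapp t' u' r) fun _ _ => .gapp₃ _ _)

theorem Steps.subst {σ σ' : ℕ → JTerm} (h : ∀ x, Steps (σ x) (σ' x)) (t : JTerm) :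
    Steps (JTerm.subst σ t) (JTerm.subst σ' t) := by
  have hup {σ σ' : ℕ → JTerm} (h : ∀ x, Steps (σ x) (σ' x)) (x : ℕ) :
      Steps (up σ x) (up σ' x) := by
    cases x
    · exact .refl
    · exact (h _).lift _ fun _ _ h => h.rename _
  induction t generalizing σ σ' with
  | var x => exact h x
  | lam t ih => exact (ih (hup h)).lam
  | gapp t u r iht ihu ihr => exact (iht h).gapp (ihu h) (ihr (hup h))

theorem Steps.inst (t : JTerm) {u u' : JTerm} (h : Steps u u') :
    Steps (JTerm.inst t u) (JTerm.inst t u') := by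
  refine Steps.subst (fun x => ?_) t
  cases x
  · exact h
  · exact .refl

theorem Step.inst {t t' : JTerm} (h : Step t t') (u : JTerm) :
    Step (JTerm.inst t u) (JTerm.inst t' u) := h.subst _

theorem Step.appArgs {t t' : JTerm} (h : Step t t') (Ss : List (JTerm × JTerm)) :
    Step (JTerm.appArgs t Ss) (JTerm.appArgs t' Ss) := by
  induction Ss generalizing t t' with
  | nil => exact h
  | cons S Ss ih => exact ih (h.gapp₁ _ _)

/-- Renaming reflects reduction. -/
theorem Step.of_rename {a s : JTerm} (h : Step a s) {ρ : ℕ → ℕ} {t : JTerm}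
    (ha : a = JTerm.rename ρ t) : ∃ t', Step t t' ∧ s = JTerm.rename ρ t' := by
  induction h generalizing ρ t with
  | beta a b c =>
    cases t with
    | var | lam => cases ha
    | gapp t u r =>
      cases t with
      | var | gapp => cases ha
      | lam t =>
        cases ha
        exact ⟨_, .beta t u r, by rw [rename_inst, rename_inst]⟩
  | pi a b c S =>
    cases t with
    | var | lam => cases ha
    | gapp t u r =>
      cases t with
      | var | lam => cases ha
      | gapp t u' r' =>
        obtain ⟨v, s⟩ := S
        cases ha
        refine ⟨_, .pi t u' r' (u, r), ?_⟩
        simp only [appArg, JTerm.rename, shiftArg, shift, rename_rename]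
        congr 3
        funext n; cases n <;> rfl
  | lam _ ih =>
    cases t with
    | var | gapp => cases ha
    | lam t =>
      cases ha
      obtain ⟨t', ht, rfl⟩ := ih rfl
      exact ⟨_, ht.lam, rfl⟩
  | gapp₁ _ _ _ ih =>
    cases t with
    | var | lam => cases ha
    | gapp t u r =>
      cases ha
      obtain ⟨t', ht, rfl⟩ := ih rfl
      exact ⟨_, ht.gapp₁ _ _, rfl⟩
  | gapp₂ _ _ _ ih =>
    cases t with
    | var | lam => cases ha
    | gapp t u r =>
      cases ha
      obtain ⟨t', ht, rfl⟩ := ih rfl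
      exact ⟨_, ht.gapp₂ _ _, rfl⟩
  | gapp₃ _ _ _ ih =>
    cases t with
    | var | lam => cases ha
    | gapp t u r =>
      cases ha
      obtain ⟨t', ht, rfl⟩ := ih rfl
      exact ⟨_, ht.gapp₃ _ _, rfl⟩

theorem SN.rename {t : JTerm} (h : SN t) (ρ : ℕ → ℕ) : SN (JTerm.rename ρ t) := by
  induction h with
  | intro t _ ih =>
    refine ⟨_, fun s hs => ?_⟩
    obtain ⟨t', ht, rfl⟩ := Step.of_rename hs rfl
    exact ih t' ht

theorem SN.of_subst {σ : ℕ → JTerm} {t : JTerm} (h : SN (subst σ t)) : SN t :=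
  StronglyNormalizing.of_map (JTerm.subst σ) (fun _ _ h => h.subst σ) h

theorem SN.var (x : ℕ) : SN (var x) := ⟨_, fun _ h => nomatch h⟩

theorem SN.lam {t : JTerm} (h : SN t) : SN (lam t) := by
  induction h with
  | intro t _ ih =>
    refine ⟨_, fun s hs => ?_⟩
    cases hs with
    | lam h => exact ih _ h

theorem SN.gapp_var (x : ℕ) {u r : JTerm} (hu : SN u) (hr : SN r) :
    SN (gapp (JTerm.var x) u r) := by
  induction hu generalizing r with
  | intro u hu ihu =>
    induction hr with
    | intro r hr ihr =>
      refine ⟨_, fun s hs => ?_⟩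
      cases hs with
      | gapp₁ _ _ h => cases h
      | gapp₂ _ _ h => exact ihu _ h ⟨_, hr⟩
      | gapp₃ _ _ h => exact ihr _ h

/-! ### Accessibility for reduction and the subterm relation -/

/-- `Sub s t`: `s` is an immediate subterm of `t`. -/
inductive Sub : JTerm → JTerm → Prop
  | lam (t : JTerm) : Sub t (lam t)
  | gapp₁ (t u r : JTerm) : Sub t (gapp t u r)
  | gapp₂ (t u r : JTerm) : Sub u (gapp t u r)
  | gapp₃ (t u r : JTerm) : Sub r (gapp t u r)

theorem Sub.wellFounded : WellFounded Sub := by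
  refine ⟨fun t => ?_⟩
  induction t with
  | var x => exact ⟨_, fun _ h => nomatch h⟩
  | lam t ih => exact ⟨_, fun _ h => by cases h; exact ih⟩
  | gapp t u r iht ihu ihr => exact ⟨_, fun _ h => by cases h <;> assumption⟩

/-- `Below b a`: `b` is obtained from `a` by reduction steps and passages to a subterm, at least
one in total. -/
def Below : JTerm → JTerm → Prop := Relation.TransGen fun b a => Step a b ∨ Sub b a

theorem Below.trans {a b c : JTerm} (h : Below a b) (h' : Below b c) : Below a c :=
  Relation.TransGen.trans h h'

theorem Step.toBelow {a b : JTerm} (h : Step a b) : Below b a := .single (.inl h)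

theorem Sub.toBelow {a b : JTerm} (h : Sub b a) : Below b a := .single (.inr h)

/-- Since reduction is closed under all constructors, a step in a subterm lifts to the whole term,
which is the commutation needed by `acc_union`. This is the induction principle of all the main
lemmas. -/
theorem SN.acc_below {t : JTerm} (h : SN t) : Acc Below t := by
  refine Acc.transGen (StronglyNormalizing.acc_union Sub.wellFounded ?_ h)
  intro s t s' hst hs
  cases hst with
  | lam => exact ⟨_, hs.lam, .lam _⟩
  | gapp₁ => exact ⟨_, hs.gapp₁ _ _, .gapp₁ _ _ _⟩
  | gapp₂ => exact ⟨_, hs.gapp₂ _ _, .gapp₂ _ _ _⟩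
  | gapp₃ => exact ⟨_, hs.gapp₃ _ _, .gapp₃ _ _ _⟩

theorem Below.appArgs {s t : JTerm} (h : Below s t) (Ss : List (JTerm × JTerm)) :
    Below s (JTerm.appArgs t Ss) := by
  induction Ss generalizing t with
  | nil => exact h
  | cons S Ss ih => exact ih (h.trans (Sub.gapp₁ _ _ _).toBelow)

/-- Every term is a variable or an abstraction, applied to generalized arguments. -/
theorem exists_appArgs (t : JTerm) : ∃ h Ss, t = appArgs h Ss ∧
    ((∃ x, h = var x) ∨ ∃ t', h = lam t') := by
  induction t with
  | var x => exact ⟨_, [], rfl, .inl ⟨x, rfl⟩⟩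
  | lam t _ => exact ⟨_, [], rfl, .inr ⟨t, rfl⟩⟩
  | gapp t u r iht _ _ =>
    obtain ⟨h, Ss, rfl, hh⟩ := iht
    exact ⟨h, Ss ++ [(u, r)], by simp [appArgs, appArg], hh⟩

/-! ### Head expansions preserve strong normalization -/

/-- The number of generalized arguments to which the head of a term is applied. -/
def spineLength : JTerm → ℕ
  | var _ => 0
  | lam _ => 0
  | gapp t _ _ => spineLength t + 1

/-- `HeadBeta t u a b`: the term `a` reduces to `b` by contraction of a head redex
`(λ x. t)(u, y. r)`. -/
inductive HeadBeta (t u : JTerm) : JTerm → JTerm → Prop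
  | base (r : JTerm) : HeadBeta t u (gapp (lam t) u r) (inst r (inst t u))
  | app {a b : JTerm} (v s : JTerm) : HeadBeta t u a b → HeadBeta t u (gapp a v s) (gapp b v s)

theorem HeadBeta.appArgs {t u a b : JTerm} (h : HeadBeta t u a b) (Ss : List (JTerm × JTerm)) :
    HeadBeta t u (appArgs a Ss) (appArgs b Ss) := by
  induction Ss generalizing a b with
  | nil => exact h
  | cons S Ss ih => exact ih (h.app _ _)

theorem inst_appArg_shiftArg (r w : JTerm) (S : JTerm × JTerm) :
    inst (appArg r (shiftArg S)) w = appArg (inst r w) S := by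
  have := substArg_substArg (fun n => var (n + 1)) (single w) S
  rw [← shiftArg_eq] at this
  exact congrArg (appArg (inst r w)) (this.trans (substArg_var S))

/-- Steps inside `t` and `u` are kept apart from the others because their copies in `b` may be
absent, in which case `b` does not move. -/
theorem HeadBeta.step_cases {t u a b a' : JTerm} (h : HeadBeta t u a b) (ha : Step a a') :
    a' = b ∨ (∃ b', Step b b' ∧ HeadBeta t u a' b') ∨
    (HeadBeta t u a' b ∧ spineLength a' < spineLength a) ∨
    (∃ t' b', Step t t' ∧ Steps b b' ∧ HeadBeta t' u a' b') ∨
    (∃ u' b', Step u u' ∧ Steps b b' ∧ HeadBeta t u' a' b') := by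
  induction h generalizing a' with
  | base r =>
    cases ha with
    | beta => exact .inl rfl
    | gapp₁ _ _ h =>
      cases h with
      | lam h =>
        exact .inr <| .inr <| .inr <| .inl
          ⟨_, _, h, Steps.inst _ (.single (h.inst _)), .base _⟩
    | gapp₂ _ _ h =>
      exact .inr <| .inr <| .inr <| .inr
        ⟨_, _, h, Steps.inst _ (Steps.inst _ (.single h)), .base _⟩
    | gapp₃ _ _ h => exact .inr <| .inl ⟨_, h.inst _, .base _⟩
  | @app a b v s hab ih =>
    cases ha with
    | beta => cases hab
    | pi a u₂ r₂ S =>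
      cases hab with
      | base r =>
        -- The π-step absorbs the next argument into the redex. The contractum is the same, as the
        -- bound variable is not free in that argument, but the spine has become shorter.
        refine .inr <| .inr <| .inl ⟨?_, by simp [spineLength]⟩
        have := HeadBeta.base (t := t) (u := u) (JTerm.appArg r₂ (shiftArg S))
        rwa [inst_appArg_shiftArg] at this
      | app _ _ hab => exact .inr <| .inl ⟨_, .pi _ _ _ S, hab.app _ _⟩
    | gapp₁ _ _ h =>
      rcases ih h with rfl | ⟨b', hb, h'⟩ | ⟨h', hl⟩ | ⟨t', b', ht, hb, h'⟩ | ⟨u', b', hu, hb, h'⟩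
      · exact .inl rfl
      · exact .inr <| .inl ⟨_, hb.gapp₁ _ _, h'.app _ _⟩
      · exact .inr <| .inr <| .inl ⟨h'.app _ _, by simpa [spineLength] using hl⟩
      · exact .inr <| .inr <| .inr <| .inl ⟨_, _, ht, hb.gapp .refl .refl, h'.app _ _⟩
      · exact .inr <| .inr <| .inr <| .inr ⟨_, _, hu, hb.gapp .refl .refl, h'.app _ _⟩
    | gapp₂ _ _ h => exact .inr <| .inl ⟨_, h.gapp₂ _ _, hab.app _ _⟩
    | gapp₃ _ _ h => exact .inr <| .inl ⟨_, h.gapp₃ _ _, hab.app _ _⟩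

/-- Lexicographic induction on `b`, `t`, `u` and the spine length of `a`: each step of `a` other
than the head contraction decreases one component and leaves the earlier ones unchanged. -/
theorem HeadBeta.sn {t u a b : JTerm} (h : HeadBeta t u a b) (hb : SN b) (ht : SN t)
    (hu : SN u) : SN a := by
  have hb' := StronglyNormalizing.transGen hb
  induction hb' generalizing t u a with
  | intro b _ ihb =>
    have ihb' {b'} (hbb' : Relation.TransGen Step b b') {t u a} (h : HeadBeta t u a b')
        (ht : SN t) (hu : SN u) : SN a :=
      ihb b' hbb' h (hb.steps hbb'.to_reflTransGen) ht hu
    induction ht generalizing u a with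
    | intro t ht iht =>
      induction hu generalizing a with
      | intro u hu ihu =>
        generalize hn : spineLength a = n
        induction n using Nat.strong_induction_on generalizing a with
        | _ n ihn =>
          subst hn
          have ht' : SN t := ⟨_, ht⟩
          have hu' : SN u := ⟨_, hu⟩
          refine ⟨_, fun a' ha => ?_⟩
          rcases h.step_cases ha with rfl | ⟨b', hbb, h'⟩ | ⟨h', hl⟩ | ⟨t', b', hs, hbb, h'⟩ |
            ⟨u', b', hs, hbb, h'⟩
          · exact hb
          · exact ihb' (.single hbb) h' ht' hu'
          · exact ihn _ hl h' rfl
          · rcases Relation.reflTransGen_iff_eq_or_transGen.mp hbb with rfl | hbb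
            · exact iht t' hs h' hu'
            · exact ihb' hbb h' (ht'.step hs) hu'
          · rcases Relation.reflTransGen_iff_eq_or_transGen.mp hbb with rfl | hbb
            · exact ihu u' hs h'
            · exact ihb' hbb h' ht' (hu'.step hs)

theorem SN.beta_expansion {t u r : JTerm} {Ss : List (JTerm × JTerm)}
    (h : SN (appArgs (inst r (inst t u)) Ss)) (ht : SN t) (hu : SN u) :
    SN (appArgs (gapp (JTerm.lam t) u r) Ss) :=
  ((HeadBeta.base r).appArgs Ss).sn h ht hu

/-- `HeadPi a b`: the term `a` reduces to `b` by contraction of a head redex `x(u, y. r) S`. -/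
inductive HeadPi : JTerm → JTerm → Prop
  | base (x : ℕ) (u r v s : JTerm) :
      HeadPi (gapp (gapp (var x) u r) v s) (gapp (var x) u (appArg r (shiftArg (v, s))))
  | app {a b : JTerm} (v s : JTerm) : HeadPi a b → HeadPi (gapp a v s) (gapp b v s)

theorem HeadPi.appArgs {a b : JTerm} (h : HeadPi a b) (Ss : List (JTerm × JTerm)) :
    HeadPi (appArgs a Ss) (appArgs b Ss) := by
  induction Ss generalizing a b with
  | nil => exact h
  | cons S Ss ih => exact ih (h.app _ _)

theorem shiftArg_appArg (u r : JTerm) (S : JTerm × JTerm) :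
    shiftArg (u, appArg r (shiftArg S)) =
      ((shiftArg (u, r)).1, appArg (shiftArg (u, r)).2 (shiftArg (shiftArg S))) := by
  simp only [shiftArg, appArg, JTerm.rename, shift, rename_rename]
  congr 3
  funext n; cases n <;> rfl

/-- Contracting a π-redex erases nothing, so every other step of `a` is matched by at least one step
of `b`, and no side condition is needed for the expansion. -/
theorem HeadPi.step_cases {a b a' : JTerm} (h : HeadPi a b) (ha : Step a a') :
    a' = b ∨ ∃ b', Relation.TransGen Step b b' ∧ HeadPi a' b' := by
  induction h generalizing a' with
  | base x u r v s =>
    cases ha with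
    | pi => exact .inl rfl
    | gapp₁ _ _ h =>
      cases h with
      | gapp₁ _ _ h => cases h
      | gapp₂ _ _ h => exact .inr ⟨_, .single (h.gapp₂ _ _), .base _ _ _ _ _⟩
      | gapp₃ _ _ h => exact .inr ⟨_, .single ((h.gapp₁ _ _).gapp₃ _ _), .base _ _ _ _ _⟩
    | gapp₂ _ _ h =>
      exact .inr ⟨_, .single (((h.rename _).gapp₂ _ _).gapp₃ _ _), .base _ _ _ _ _⟩
    | gapp₃ _ _ h =>
      exact .inr ⟨_, .single (((h.rename _).gapp₃ _ _).gapp₃ _ _), .base _ _ _ _ _⟩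
  | @app a b v s hab ih =>
    cases ha with
    | beta => cases hab
    | pi a u₂ r₂ S =>
      cases hab with
      | base x u r =>
        -- Overlap of two π-redexes in `x(u,y.r)(u₂,z.r₂)S`: after the outer one is contracted
        -- first, the pair is rejoined by two π-steps from `x(u,y.r(u₂,z.r₂))S`.
        refine .inr ⟨_, .tail (.single (.pi _ _ _ S)) (.gapp₃ _ _ (.pi _ _ _ _)), ?_⟩
        have := HeadPi.base x u r u₂ (JTerm.appArg r₂ (shiftArg S))
        rwa [shiftArg_appArg] at this
      | app _ _ hab => exact .inr ⟨_, .single (.pi _ _ _ S), hab.app _ _⟩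
    | gapp₁ _ _ h =>
      rcases ih h with rfl | ⟨b', hb, h'⟩
      · exact .inl rfl
      · exact .inr ⟨_, hb.lift (fun t => gapp t v s) fun _ _ h => h.gapp₁ _ _, h'.app _ _⟩
    | gapp₂ _ _ h => exact .inr ⟨_, .single (h.gapp₂ _ _), hab.app _ _⟩
    | gapp₃ _ _ h => exact .inr ⟨_, .single (h.gapp₃ _ _), hab.app _ _⟩

theorem HeadPi.sn {a b : JTerm} (h : HeadPi a b) (hb : SN b) : SN a := by
  have hb' := StronglyNormalizing.transGen hb
  induction hb' generalizing a with
  | intro b _ ih =>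
    refine ⟨_, fun a' ha => ?_⟩
    rcases h.step_cases ha with rfl | ⟨b', hbb, h'⟩
    · exact hb
    · exact ih b' hbb h' (hb.steps hbb.to_reflTransGen)

theorem SN.pi_expansion {x : ℕ} {u r : JTerm} {S : JTerm × JTerm} {Ss : List (JTerm × JTerm)}
    (h : SN (appArgs (gapp (JTerm.var x) u (appArg r (shiftArg S))) Ss)) :
    SN (appArgs (appArg (gapp (JTerm.var x) u r) S) Ss) :=
  ((HeadPi.base x u r S.1 S.2).appArgs Ss).sn h

theorem SN.pi_expansions {x : ℕ} {u r : JTerm} {Ss : List (JTerm × JTerm)}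
    (h : SN (gapp (JTerm.var x) u (appArgs r (Ss.map shiftArg)))) :
    SN (appArgs (gapp (JTerm.var x) u r) Ss) := by
  induction Ss generalizing r with
  | nil => exact h
  | cons S Ss ih => exact pi_expansion (ih h)

/-! ### Strongly normalizing terms belong to the inductive predicate -/

/-- The shape of the head selects one clause of `ISN`, and every premise of that clause is a reduct,
a subterm, or a subterm of a subterm. -/
theorem SN.isn {t : JTerm} (h : SN t) : ISN t := by
  have hacc := h.acc_below
  clear h
  induction hacc with
  | intro t _ ih =>
    obtain ⟨h, Ss, rfl, ⟨x, rfl⟩ | ⟨t, rfl⟩⟩ := exists_appArgs t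
    · match Ss with
      | [] => exact .var x
      | [S] => exact .hvar x (ih _ (Sub.gapp₂ _ _ _).toBelow) (ih _ (Sub.gapp₃ _ _ _).toBelow)
      | S :: S' :: Ss => exact .pi x _ _ _ _ (ih _ ((Step.pi _ _ _ S').appArgs Ss).toBelow)
    · match Ss with
      | [] => exact .lam (ih _ (Sub.lam _).toBelow)
      | S :: Ss =>
        exact .beta _ _ _ _ (ih _ ((Step.beta _ _ _).appArgs Ss).toBelow)
          (ih _ (((Sub.lam _).toBelow.trans (Sub.gapp₁ _ S.1 S.2).toBelow).appArgs Ss))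
          (ih _ ((Sub.gapp₂ _ S.1 S.2).toBelow.appArgs Ss))

/-! ### Substitution of head-expanded terms -/

/-- Replacing `b` by `a` in head position preserves strong normalization. -/
def HeadExpands (a b : JTerm) : Prop :=
  ∀ (ρ : ℕ → ℕ) (Ss : List (JTerm × JTerm)),
    SN (appArgs (rename ρ b) Ss) → SN (appArgs (rename ρ a) Ss)

theorem HeadExpands.trans {a b c : JTerm} (h : HeadExpands a b) (h' : HeadExpands b c) :
    HeadExpands a c := fun ρ Ss hc => h ρ Ss (h' ρ Ss hc)

theorem HeadExpands.rename {a b : JTerm} (h : HeadExpands a b) (ρ : ℕ → ℕ) :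
    HeadExpands (JTerm.rename ρ a) (JTerm.rename ρ b) := fun ρ' Ss hb => by
  rw [rename_rename] at hb ⊢
  exact h _ Ss hb

theorem HeadExpands.gapp {a b : JTerm} (h : HeadExpands a b) (u r : JTerm) :
    HeadExpands (gapp a u r) (gapp b u r) := fun ρ Ss hb =>
  h ρ ((JTerm.rename ρ u, JTerm.rename (upRen ρ) r) :: Ss) hb

theorem HeadExpands.beta {t u : JTerm} (r : JTerm) (ht : SN t) (hu : SN u) :
    HeadExpands (JTerm.gapp (lam t) u r) (inst r (inst t u)) := fun ρ Ss h => by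
  rw [rename_inst, rename_inst] at h
  exact h.beta_expansion (ht.rename _) (hu.rename _)

theorem HeadExpands.idTerm {u : JTerm} (r : JTerm) (hu : SN u) :
    HeadExpands (JTerm.gapp idTerm u r) (inst r u) :=
  HeadExpands.beta r (SN.var 0) hu

/-- By π, all later arguments move inside, giving `x(u, z. z Ss)`. Its body becomes `y Ss` when `z`
is replaced by `y`, and substitution reflects strong normalization. -/
theorem HeadExpands.var_gapp (x y : ℕ) {u : JTerm} (hu : SN u) :
    HeadExpands (JTerm.gapp (var x) u (var 0)) (var y) := fun ρ Ss h => by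
  refine SN.pi_expansions (SN.gapp_var _ (hu.rename _) ?_)
  refine SN.of_subst (σ := single (JTerm.var (ρ y))) ?_
  rw [subst_appArgs, List.map_map]
  have : substArg (single (JTerm.var (ρ y))) ∘ shiftArg = id := by
    funext S
    rw [Function.comp, shiftArg_eq, substArg_substArg]
    exact substArg_var S
  rw [this, List.map_id]
  exact h

/-- Induction on `subst σ' M` along reduction and subterms, for all `M`, `σ`, `σ'` at once. An
unreplaced head of `M` can be analysed as in `SN.isn`. A replaced head `x` is expanded last, after
the arguments have been treated with `σ' x` still in head position. -/
theorem SN.subst_of_headExpands {M : JTerm} {σ σ' : ℕ → JTerm} (h : SN (subst σ' M))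
    (hσ : ∀ x, (∃ y, σ x = JTerm.var y ∧ σ' x = JTerm.var y) ∨ HeadExpands (σ x) (σ' x)) :
    SN (subst σ M) := by
  have hacc := h.acc_below
  clear h
  generalize hc : subst σ' M = c at hacc
  induction hacc generalizing M σ σ' with
  | intro c _ ih =>
    -- the case where the head of `M` is not replaced
    have key : ∀ (h : JTerm) (Ss : List (JTerm × JTerm)) (σ σ' : ℕ → JTerm),
        (∀ x, (∃ y, σ x = JTerm.var y ∧ σ' x = JTerm.var y) ∨ HeadExpands (σ x) (σ' x)) →
        subst σ' (appArgs h Ss) = c →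
        ((∃ x y, h = JTerm.var x ∧ σ x = JTerm.var y ∧ σ' x = JTerm.var y) ∨
          ∃ t, h = JTerm.lam t) →
        SN (subst σ (appArgs h Ss)) := by
      intro h Ss σ σ' hσ hc hh
      have hup : ∀ x, (∃ y, up σ x = JTerm.var y ∧ up σ' x = JTerm.var y) ∨
          HeadExpands (up σ x) (up σ' x) := by
        rintro (_ | x)
        · exact .inl ⟨0, rfl, rfl⟩
        · rcases hσ x with ⟨y, h₁, h₂⟩ | h
          · exact .inl ⟨y + 1, by rw [up, h₁]; rfl, by rw [up, h₂]; rfl⟩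
          · exact .inr (h.rename _)
      subst hc
      rcases hh with ⟨x, y, rfl, hx, hx'⟩ | ⟨t, rfl⟩
      · match Ss with
        | [] =>
          change SN (σ x)
          rw [hx]
          exact .var y
        | [S] =>
          change SN (JTerm.gapp (σ x) (subst σ S.1) (subst (up σ) S.2))
          rw [hx]
          exact .gapp_var y (ih _ (Sub.gapp₂ _ _ _).toBelow hσ rfl)
            (ih _ (Sub.gapp₃ _ _ _).toBelow hup rfl)
        | S :: S' :: Ss =>
          have hstep := (Step.pi (JTerm.var x) S.1 S.2 S').appArgs Ss
          have := ih _ (hstep.subst σ').toBelow hσ rfl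
          rw [subst_appArgs] at this ⊢
          simp only [subst, appArg, hx, List.map_cons] at this ⊢
          refine SN.pi_expansion ?_
          simpa only [appArg, shiftArg, substArg, subst_up_shift, subst_up_up_rename] using this
      · match Ss with
        | [] => exact .lam (ih _ (Sub.lam _).toBelow hup rfl)
        | S :: Ss =>
          have hstep := (Step.beta t S.1 S.2).appArgs Ss
          have := ih _ (hstep.subst σ').toBelow hσ rfl
          rw [subst_appArgs, subst_inst, subst_inst] at this
          rw [subst_appArgs]
          refine SN.beta_expansion this (ih _ ?_ hup rfl) (ih _ ?_ hσ rfl)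
          · rw [subst_appArgs]
            exact ((Sub.lam _).toBelow.trans (Sub.gapp₁ _ _ _).toBelow).appArgs _
          · rw [subst_appArgs]
            exact (Sub.gapp₂ _ _ _).toBelow.appArgs _
    obtain ⟨h, Ss, rfl, hh⟩ := exists_appArgs M
    rcases hh with ⟨x, rfl⟩ | hh
    · rcases hσ x with ⟨y, hy⟩ | hx
      · exact key _ Ss σ σ' hσ hc (.inl ⟨x, y, rfl, hy⟩)
      · -- even indices are the free variables of `σ' x`, odd ones the variables of `M`
        let mix (τ : ℕ → JTerm) (n : ℕ) : JTerm :=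
          if n % 2 = 0 then JTerm.var (n / 2) else τ (n / 2)
        have hmix₀ (τ : ℕ → JTerm) (t : JTerm) :
            subst (mix τ) (JTerm.rename (fun n => 2 * n) t) = t := by
          rw [subst_rename]
          refine Eq.trans ?_ (subst_var t)
          congr 1; funext n; simp [mix]
        have hmix₁ (τ : ℕ → JTerm) (S : JTerm × JTerm) :
            substArg (mix τ) (substArg (fun n => JTerm.var (2 * n + 1)) S) = substArg τ S := by
          rw [substArg_substArg]
          congr 1; funext n
          have h₁ : (2 * n + 1) % 2 = 1 := by omega
          have h₂ : (2 * n + 1) / 2 = n := by omega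
          simp [mix, subst, h₁, h₂]
        have hmixσ : ∀ n, (∃ y, mix σ n = JTerm.var y ∧ mix σ' n = JTerm.var y) ∨
            HeadExpands (mix σ n) (mix σ' n) := by
          intro n
          by_cases hn : n % 2 = 0
          · exact .inl ⟨n / 2, by simp [mix, hn], by simp [mix, hn]⟩
          · simpa [mix, hn] using hσ (n / 2)
        have hsubst (τ : ℕ → JTerm) : subst (mix τ) (appArgs (JTerm.rename (fun n => 2 * n) (σ' x))
            (Ss.map (substArg fun n => JTerm.var (2 * n + 1)))) =
            appArgs (σ' x) (Ss.map (substArg τ)) := by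
          rw [subst_appArgs, hmix₀, List.map_map]
          congr 2; funext S; exact hmix₁ τ S
        -- With variables separated by parity, `σ' x` becomes part of the term being substituted
        -- into. Under `mix σ'` its value is still `c`, and its head is now an abstraction or a
        -- variable that is not replaced, so `key` applies without any decrease of `c`.
        have hsn : SN (appArgs (σ' x) (Ss.map (substArg σ))) := by
          rw [subst_appArgs] at hc
          rw [← hsubst]
          obtain ⟨h, Ts, hb, hh⟩ := exists_appArgs (σ' x)
          have happ : appArgs (JTerm.rename (fun n => 2 * n) (σ' x))
              (Ss.map (substArg fun n => JTerm.var (2 * n + 1))) =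
              appArgs (JTerm.rename (fun n => 2 * n) h)
                (Ts.map (substArg fun n => JTerm.var (2 * n)) ++
                  Ss.map (substArg fun n => JTerm.var (2 * n + 1))) := by
            rw [hb, rename_eq_subst, subst_appArgs, rename_eq_subst]
            simp only [appArgs, List.foldl_append]
            rfl
          have hc' := (hsubst σ').trans hc
          rw [happ] at hc' ⊢
          refine key _ _ _ _ hmixσ hc' ?_
          rcases hh with ⟨y, rfl⟩ | ⟨t, rfl⟩
          · exact .inl ⟨2 * y, y, rfl, by simp [mix], by simp [mix]⟩
          · exact .inr ⟨_, rfl⟩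
        rw [subst_appArgs]
        have := hx id (Ss.map (substArg σ))
        rw [rename_id, rename_id] at this
        exact this hsn
    · exact key h Ss σ σ' hσ hc (.inr hh)

theorem SN.inst_of_headExpands {r a b : JTerm} (h : SN (inst r b)) (hab : HeadExpands a b) :
    SN (inst r a) := by
  refine SN.subst_of_headExpands h ?_
  rintro (_ | x)
  · exact .inr hab
  · exact .inl ⟨x, rfl, rfl⟩

/-! ### The composite translation preserves strong normalization -/

theorem inst_splitArg (p q r : JTerm) :
    inst (subst (up (single p)) (subst splitArg r)) q = inst r (gapp p q (var 0)) := by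
  simp only [inst, subst_subst]
  congr 1; funext n; cases n
  · simp only [splitArg, subst, up, single]
    congr 1
    exact inst_shift p q
  · rfl

theorem inst_gapp_idTerm_shift (p q r : JTerm) :
    inst (gapp idTerm (shift q) (subst splitArg r)) p =
      gapp idTerm q (subst (up (single p)) (subst splitArg r)) := by
  have := inst_shift q p
  rw [inst] at this ⊢
  rw [subst, this]; rfl

theorem HeadExpands.toJJ_gapp {t u r : JTerm} (ht : SN t.toJJ) (hu : SN u.toJJ) :
    HeadExpands (JTerm.gapp t u r).toJJ
      (inst r.toJJ (JTerm.gapp t.toJJ u.toJJ (JTerm.var 0))) := by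
  rw [JTerm.toJJ_gapp]
  have h₁ := HeadExpands.idTerm (JTerm.gapp JTerm.idTerm (shift u.toJJ) (subst splitArg r.toJJ)) ht
  rw [inst_gapp_idTerm_shift] at h₁
  have h₂ := HeadExpands.idTerm (subst (up (single t.toJJ)) (subst splitArg r.toJJ)) hu
  rw [inst_splitArg] at h₂
  exact h₁.trans h₂

theorem HeadExpands.sn {a b : JTerm} (h : HeadExpands a b) (hb : SN b) : SN a := by
  have := h id []
  rw [rename_id, rename_id] at this
  exact this hb

theorem steps_toJJ_gapp (t u r : JTerm) :
    Steps (gapp t u r).toJJ (inst r.toJJ (gapp t.toJJ u.toJJ (var 0))) := by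
  rw [JTerm.toJJ_gapp]
  have h₁ := Step.beta (var 0) t.toJJ (gapp JTerm.idTerm (shift u.toJJ) (subst splitArg r.toJJ))
  have h₂ := Step.beta (var 0) u.toJJ (subst (up (single t.toJJ)) (subst splitArg r.toJJ))
  change Step _ (inst _ t.toJJ) at h₁
  change Step _ (inst _ u.toJJ) at h₂
  rw [inst_gapp_idTerm_shift] at h₁
  rw [inst_splitArg] at h₂
  exact .tail (.single h₁) h₂

/-- For an application, expanding the two identity redexes leaves `{t*°(u*°,z.z)/x} s*°`, which is
handled according to the form of `t`. -/
theorem SN.toJJ {t : JTerm} (h : SN t) : SN t.toJJ := by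
  have hacc := h.acc_below
  clear h
  induction hacc with
  | intro t _ ih =>
    match t with
    | .var x => exact .var x
    | .lam t => exact .lam (ih t (Sub.lam _).toBelow)
    | .gapp t u s =>
      have ht := ih t (Sub.gapp₁ _ _ _).toBelow
      have hu := ih u (Sub.gapp₂ _ _ _).toBelow
      have hs := ih s (Sub.gapp₃ _ _ _).toBelow
      refine (HeadExpands.toJJ_gapp ht hu).sn ?_
      match t with
      | .var x =>
        refine SN.inst_of_headExpands ?_ (HeadExpands.var_gapp x 0 hu)
        -- Instantiating index `0` by variable `0` is this renaming, where the truncated `0 - 1 = 0`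
        -- keeps the index in place.
        have := hs.rename (fun n => n - 1)
        rw [rename_eq_subst] at this
        convert this using 1
        rw [inst]; congr 1; funext n; cases n <;> rfl
      | .lam t =>
        have hc := ih _ (Step.beta t u s).toBelow
        rw [toJJ_inst, toJJ_inst] at hc
        have ht₁ := ih t ((Sub.lam _).toBelow.trans (Sub.gapp₁ _ _ _).toBelow)
        exact SN.inst_of_headExpands hc (HeadExpands.beta (JTerm.var 0) ht₁ hu)
      | .gapp t v r =>
        have hp := ih _ (Step.pi t v r (u, s)).toBelow
        have ht₁ := ih t ((Sub.gapp₁ _ _ _).toBelow.trans (Sub.gapp₁ _ _ _).toBelow)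
        have hv := ih v ((Sub.gapp₂ _ _ _).toBelow.trans (Sub.gapp₁ _ _ _).toBelow)
        -- The image of the π-reduct contains two nested pairs of identity redexes. Contracting both
        -- gives the goal up to head expansion of the inner application, after cancelling the
        -- weakenings of `u` and `s`.
        have hc := hp.steps (steps_toJJ_gapp _ _ _)
        have hc' := hc.steps ((steps_toJJ_gapp r (shift u) (JTerm.rename (upRen Nat.succ) s)).lift _
          fun _ _ h => h.inst _)
        refine SN.inst_of_headExpands ?_
          ((HeadExpands.toJJ_gapp (r := r) ht₁ hv).gapp u.toJJ (JTerm.var 0))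
        refine (congrArg SN ?_).mpr hc'
        have e₁ : (shift u).toJJ = shift u.toJJ := by
          simp only [JTerm.toJJ, shift, toES_rename, ESTerm.toJ_rename]
        have e₂ : (JTerm.rename (upRen Nat.succ) s).toJJ =
            JTerm.rename (upRen Nat.succ) s.toJJ := by
          simp only [JTerm.toJJ, toES_rename, ESTerm.toJ_rename]
        rw [e₁, e₂]
        generalize JTerm.gapp t.toJJ v.toJJ (JTerm.var 0) = w
        have hi := inst_shift u.toJJ w
        rw [inst] at hi
        simp only [inst, subst_subst, subst_rename]
        congr 1; funext n; cases n
        · simp [single, subst, upRen, hi, up]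
        · rfl

end JTerm

/-! ### Reduction of terms with explicit substitutions -/

namespace ESTerm

/-- Weakening by `k` commutes with substitution under `k` binders. -/
theorem subst_iterate_up_rename (σ : ℕ → ESTerm) (k : ℕ) (N : ESTerm) :
    subst (up^[k] σ) (rename (fun n => n + k) N) = rename (fun n => n + k) (subst σ N) := by
  have h (n : ℕ) : (up^[k] σ) (n + k) = rename (fun n => n + k) (σ n) := by
    induction k with
    | zero => exact (rename_id _).symm
    | succ k ih =>
      rw [Function.iterate_succ_apply', ← Nat.add_assoc]
      simp only [up, ih, shift, rename_rename]
      rfl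
  simp only [subst_rename, rename_subst]
  congr 1; funext n; exact h n

theorem subst_plug (σ : ℕ → ESTerm) (L : List ESTerm) :
    ∃ L' : List ESTerm, L'.length = L.length ∧
      ∀ M, subst σ (plug L M) = plug L' (subst (up^[L.length] σ) M) := by
  induction L generalizing σ with
  | nil => exact ⟨[], rfl, fun _ => rfl⟩
  | cons P L ih =>
    obtain ⟨L', hl, h⟩ := ih (up σ)
    refine ⟨subst σ P :: L', by simp [hl], fun M => ?_⟩
    simp only [plug, subst, h, List.length_cons, Function.iterate_succ_apply]

theorem Step.subst {M M' : ESTerm} (h : Step M M') (σ : ℕ → ESTerm) :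
    Step (ESTerm.subst σ M) (ESTerm.subst σ M') := by
  induction h generalizing σ with
  | dB L M N =>
    obtain ⟨L', hl, h⟩ := subst_plug σ L
    have := Step.dB L' (ESTerm.subst (up (up^[L.length] σ)) M) (ESTerm.subst σ N)
    rw [hl, ← subst_iterate_up_rename] at this
    simpa only [ESTerm.subst, h] using this
  | sub M N =>
    rw [subst_inst]
    exact .sub _ _
  | lam _ ih => exact .lam (ih _)
  | app₁ N _ ih => exact .app₁ _ (ih _)
  | app₂ M _ ih => exact .app₂ _ (ih _)
  | esub₁ N _ ih => exact .esub₁ _ (ih _)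
  | esub₂ M _ ih => exact .esub₂ _ (ih _)

theorem Step.rename {M M' : ESTerm} (h : Step M M') (ρ : ℕ → ℕ) :
    Step (ESTerm.rename ρ M) (ESTerm.rename ρ M') := by
  rw [rename_eq_subst, rename_eq_subst]; exact h.subst _

/-- Reduction in any number of steps. -/
abbrev Steps : ESTerm → ESTerm → Prop := Relation.ReflTransGen Step

theorem Steps.lam {M M' : ESTerm} (h : Steps M M') : Steps (lam M) (lam M') :=
  h.lift _ fun _ _ => .lam

theorem Steps.app {M M' N N' : ESTerm} (hM : Steps M M') (hN : Steps N N') :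
    Steps (app M N) (app M' N') :=
  (hM.lift (fun M => ESTerm.app M N) fun _ _ => .app₁ _).trans
    (hN.lift (fun N => ESTerm.app M' N) fun _ _ => .app₂ _)

theorem Steps.esub {M M' N N' : ESTerm} (hM : Steps M M') (hN : Steps N N') :
    Steps (esub M N) (esub M' N') :=
  (hM.lift (fun M => ESTerm.esub M N) fun _ _ => .esub₁ _).trans
    (hN.lift (fun N => ESTerm.esub M' N) fun _ _ => .esub₂ _)

theorem Steps.subst {σ σ' : ℕ → ESTerm} (h : ∀ x, Steps (σ x) (σ' x)) (M : ESTerm) :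
    Steps (ESTerm.subst σ M) (ESTerm.subst σ' M) := by
  have hup {σ σ' : ℕ → ESTerm} (h : ∀ x, Steps (σ x) (σ' x)) (x : ℕ) :
      Steps (up σ x) (up σ' x) := by
    cases x
    · exact .refl
    · exact (h _).lift _ fun _ _ h => h.rename _
  induction M generalizing σ σ' with
  | var x => exact h x
  | lam M ih => exact (ih (hup h)).lam
  | app M N ihM ihN => exact (ihM h).app (ihN h)
  | esub M N ihM ihN => exact (ihM (hup h)).esub (ihN h)

theorem Steps.inst (M : ESTerm) {N N' : ESTerm} (h : Steps N N') :
    Steps (ESTerm.inst M N) (ESTerm.inst M N') := by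
  refine Steps.subst (fun x => ?_) M
  cases x
  · exact h
  · exact .refl

theorem Step.inst {M M' : ESTerm} (h : Step M M') (N : ESTerm) :
    Step (ESTerm.inst M N) (ESTerm.inst M' N) := h.subst _

theorem SN.lam {M : ESTerm} (h : SN M) : SN (lam M) := by
  induction h with
  | intro M _ ih =>
    refine ⟨_, fun s hs => ?_⟩
    generalize hc : ESTerm.lam M = c at hs
    cases hs with
    | lam h => cases hc; exact ih _ h
    | dB | sub | app₁ | app₂ | esub₁ | esub₂ => cases hc

theorem plug_lam_cases (L : List ESTerm) (M : ESTerm) :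
    (L = [] ∧ plug L (lam M) = lam M) ∨
      ∃ P L', L = P :: L' ∧ plug L (lam M) = esub (plug L' (lam M)) P := by
  cases L with
  | nil => exact .inl ⟨rfl, rfl⟩
  | cons P L' => exact .inr ⟨P, L', rfl, rfl⟩

theorem var_ne_plug_lam (x : ℕ) (L : List ESTerm) (M : ESTerm) : var x ≠ plug L (lam M) := by
  cases L <;> exact fun h => nomatch h

theorem app_ne_plug_lam (P Q : ESTerm) (L : List ESTerm) (M : ESTerm) :
    app P Q ≠ plug L (lam M) := by
  cases L <;> exact fun h => nomatch h

/-- A variable applied to arguments. -/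
inductive Neutral : ESTerm → Prop
  | var (x : ℕ) : Neutral (var x)
  | app {M : ESTerm} (N : ESTerm) : Neutral M → Neutral (app M N)

theorem Neutral.ne_plug_lam {P : ESTerm} (h : Neutral P) (L : List ESTerm) (M : ESTerm) :
    P ≠ plug L (ESTerm.lam M) := by
  cases h with
  | var x => exact var_ne_plug_lam x L M
  | app N h => exact app_ne_plug_lam _ _ L M

/-- The one-step reducts of an application. -/
theorem Step.app_cases {M N P : ESTerm} (h : Step (app M N) P) :
    (∃ L M', M = plug L (ESTerm.lam M') ∧
      P = plug L (esub M' (ESTerm.rename (fun n => n + L.length) N))) ∨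
    (∃ M', Step M M' ∧ P = app M' N) ∨ ∃ N', Step N N' ∧ P = app M N' := by
  cases h with
  | dB L M' => exact .inl ⟨L, M', rfl, rfl⟩
  | app₁ _ h => exact .inr (.inl ⟨_, h, rfl⟩)
  | app₂ _ h => exact .inr (.inr ⟨_, h, rfl⟩)

theorem Neutral.step {M M' : ESTerm} (h : Neutral M) (hM : Step M M') : Neutral M' := by
  induction h generalizing M' with
  | var x => cases hM
  | app N h ih =>
    rcases hM.app_cases with ⟨L, M', rfl, -⟩ | ⟨M', hM', rfl⟩ | ⟨N', _, rfl⟩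
    · exact absurd rfl (h.ne_plug_lam L M')
    · exact (ih hM').app _
    · exact h.app _

theorem Neutral.sn_app {M N : ESTerm} (h : Neutral M) (hM : SN M) (hN : SN N) :
    SN (ESTerm.app M N) := by
  induction hM generalizing N with
  | intro M hM ihM =>
    induction hN with
    | intro N hN ihN =>
      refine ⟨_, fun P hP => ?_⟩
      rcases Step.app_cases hP with ⟨L, M', rfl, -⟩ | ⟨M', hs, rfl⟩ | ⟨N', hs, rfl⟩
      · exact absurd rfl (h.ne_plug_lam L M')
      · exact ihM _ hs (h.step hs) ⟨_, hN⟩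
      · exact ihN _ hs

/-! ### Head expansions preserve strong normalization -/

/-- `HeadSub N a b`: the term `a` reduces to `b` by execution of an explicit substitution of `N`
in head position. -/
inductive HeadSub (N : ESTerm) : ESTerm → ESTerm → Prop
  | base (M : ESTerm) : HeadSub N (esub M N) (inst M N)
  | app {a b : ESTerm} (P : ESTerm) : HeadSub N a b → HeadSub N (app a P) (app b P)

/-- As for β, steps inside `N` are separate because `N` may be erased in `b`. -/
theorem HeadSub.step_cases {N a b a' : ESTerm} (h : HeadSub N a b) (ha : Step a a') :
    a' = b ∨ (∃ b', Step b b' ∧ HeadSub N a' b') ∨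
    ∃ N' b', Step N N' ∧ Steps b b' ∧ HeadSub N' a' b' := by
  induction h generalizing a' with
  | base M =>
    cases ha with
    | sub => exact .inl rfl
    | esub₁ _ h => exact .inr (.inl ⟨_, h.inst _, .base _⟩)
    | esub₂ _ h => exact .inr (.inr ⟨_, _, h, Steps.inst _ (.single h), .base _⟩)
  | @app a b P hab ih =>
    rcases ha.app_cases with ⟨L, M, rfl, rfl⟩ | ⟨a', ha', rfl⟩ | ⟨P', hP, rfl⟩
    · rcases plug_lam_cases L M with ⟨rfl, -⟩ | ⟨Q, L, rfl, -⟩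
      · cases hab
      · cases hab
        refine .inr (.inl ⟨_, ?_, .base _⟩)
        -- A dB step across the head substitution persists after its execution: it is the step with
        -- the list context shortened by one, taken in the scope of that substitution and then
        -- instantiated by `N`.
        have := (Step.dB L M (shift P)).inst N
        rw [inst, subst] at this
        change Step (ESTerm.app _ (ESTerm.inst (shift P) N)) _ at this
        rw [inst_shift] at this
        rw [shift, rename_rename] at this
        have e : (fun n => n + L.length) ∘ Nat.succ = fun n => n + (N :: L).length := by
          funext n; simp only [List.length_cons, Function.comp]; omega
        rwa [e] at this
    · rcases ih ha' with rfl | ⟨b', hb, h'⟩ | ⟨N', b', hN, hb, h'⟩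
      · exact .inl rfl
      · exact .inr (.inl ⟨_, hb.app₁ _, h'.app _⟩)
      · exact .inr (.inr ⟨_, _, hN, hb.app .refl, h'.app _⟩)
    · exact .inr (.inl ⟨_, hP.app₂ _, hab.app _⟩)

theorem HeadSub.sn {N a b : ESTerm} (h : HeadSub N a b) (hb : SN b) (hN : SN N) : SN a := by
  have hb' := StronglyNormalizing.transGen hb
  induction hb' generalizing N a with
  | intro b _ ihb =>
    have ihb' {b'} (hbb' : Relation.TransGen Step b b') {N a} (h : HeadSub N a b')
        (hN : SN N) : SN a :=
      ihb b' hbb' h (hb.steps hbb'.to_reflTransGen) hN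
    induction hN generalizing a with
    | intro N hN ihN =>
      have hN' : SN N := ⟨_, hN⟩
      refine ⟨_, fun a' ha => ?_⟩
      rcases h.step_cases ha with rfl | ⟨b', hbb, h'⟩ | ⟨N', b', hs, hbb, h'⟩
      · exact hb
      · exact ihb' (.single hbb) h' hN'
      · rcases Relation.reflTransGen_iff_eq_or_transGen.mp hbb with rfl | hbb
        · exact ihN N' hs h'
        · exact ihb' hbb h' (hN'.step hs)

/-- `HeadB a b`: the term `a` reduces to `b` by contraction of a redex `(λ x. M) N` in head
position. -/
inductive HeadB : ESTerm → ESTerm → Prop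
  | base (M N : ESTerm) : HeadB (app (lam M) N) (esub M N)
  | app {a b : ESTerm} (P : ESTerm) : HeadB a b → HeadB (app a P) (app b P)

/-- The redex has no list context: a nonempty one would put an explicit substitution in head
position, which is the case of `HeadSub`. -/
theorem HeadB.step_cases {a b a' : ESTerm} (h : HeadB a b) (ha : Step a a') :
    a' = b ∨ ∃ b', Step b b' ∧ HeadB a' b' := by
  induction h generalizing a' with
  | base M N =>
    rcases ha.app_cases with ⟨L, M', hM, rfl⟩ | ⟨a', ha', rfl⟩ | ⟨N', hN, rfl⟩
    · rcases plug_lam_cases L M' with ⟨rfl, h⟩ | ⟨Q, L, rfl, h⟩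
      · rw [h] at hM
        cases hM
        exact .inl (congrArg (esub M) (rename_id N))
      · rw [h] at hM
        cases hM
    · generalize hc : ESTerm.lam M = c at ha'
      cases ha' with
      | lam h => cases hc; exact .inr ⟨_, h.esub₁ _, .base _ _⟩
      | dB | sub | app₁ | app₂ | esub₁ | esub₂ => cases hc
    · exact .inr ⟨_, hN.esub₂ _, .base _ _⟩
  | @app a b P hab ih =>
    rcases ha.app_cases with ⟨L, M, rfl, rfl⟩ | ⟨a', ha', rfl⟩ | ⟨P', hP, rfl⟩
    · generalize hc : plug L (ESTerm.lam M) = c at hab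
      cases hab <;> exact absurd hc.symm (app_ne_plug_lam _ _ L M)
    · rcases ih ha' with rfl | ⟨b', hb, h'⟩
      · exact .inl rfl
      · exact .inr ⟨_, hb.app₁ _, h'.app _⟩
    · exact .inr ⟨_, hP.app₂ _, hab.app _⟩

theorem HeadB.sn {a b : ESTerm} (h : HeadB a b) (hb : SN b) : SN a := by
  induction hb generalizing a with
  | intro b hb ih =>
    refine ⟨_, fun a' ha => ?_⟩
    rcases h.step_cases ha with rfl | ⟨b', hbb, h'⟩
    · exact ⟨_, hb⟩
    · exact ih b' hbb h'

theorem head_cases (M : ESTerm) : Neutral M ∨ (∃ P, M = lam P) ∨ (∃ b, HeadB M b) ∨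
    ∃ N b, HeadSub N M b := by
  induction M with
  | var x => exact .inl (.var x)
  | lam P _ => exact .inr (.inl ⟨P, rfl⟩)
  | app M N ihM _ =>
    rcases ihM with h | ⟨P, rfl⟩ | ⟨b, h⟩ | ⟨P, b, h⟩
    · exact .inl (h.app N)
    · exact .inr (.inr (.inl ⟨_, .base P N⟩))
    · exact .inr (.inr (.inl ⟨_, h.app N⟩))
    · exact .inr (.inr (.inr ⟨_, _, h.app N⟩))
  | esub M N _ _ => exact .inr (.inr (.inr ⟨_, _, .base M⟩))

/-! ### Strong normalization of the translation into generalized applications -/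

theorem HeadSub.toJ {N a b : ESTerm} (h : HeadSub N a b) :
    JTerm.Step a.toJ b.toJ ∧ JTerm.Below N.toJ a.toJ := by
  induction h with
  | base M =>
    rw [toJ_inst]
    exact ⟨JTerm.Step.beta _ _ _, (JTerm.Sub.gapp₂ _ _ _).toBelow⟩
  | app P _ ih => exact ⟨ih.1.gapp₁ _ _, ih.2.trans (JTerm.Sub.gapp₁ _ _ _).toBelow⟩

theorem HeadB.toJ {a b : ESTerm} (h : HeadB a b) :
    ∃ N c, HeadSub N b c ∧ JTerm.Step a.toJ c.toJ ∧ JTerm.Below N.toJ a.toJ := by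
  induction h with
  | base M N =>
    refine ⟨N, _, .base M, ?_, (JTerm.Sub.gapp₂ _ _ _).toBelow⟩
    rw [toJ_inst]
    exact JTerm.Step.beta M.toJ N.toJ (.var 0)
  | app P _ ih =>
    obtain ⟨N, c, h₁, h₂, h₃⟩ := ih
    exact ⟨N, _, h₁.app P, h₂.gapp₁ _ _, h₃.trans (JTerm.Sub.gapp₁ _ _ _).toBelow⟩

/-- Both `(λ x. M) N` and `[N/x] M` translate to redexes that β-reduce to the translation of `{N/x}
M`. The induction hypothesis therefore applies to the fully contracted term and to `N`; strong
normalization returns by expanding the substitution, and then the dB step when there is one. -/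
theorem SN.of_toJ {M : ESTerm} (h : JTerm.SN M.toJ) : SN M := by
  have hacc := h.acc_below
  clear h
  generalize hc : M.toJ = c at hacc
  induction hacc generalizing M with
  | intro c _ ih =>
    subst hc
    rcases head_cases M with h | ⟨P, rfl⟩ | ⟨b, h⟩ | ⟨N, b, h⟩
    · cases h with
      | var x => exact ⟨_, fun _ h => nomatch h⟩
      | app N h =>
        exact h.sn_app (ih _ (JTerm.Sub.gapp₁ _ _ _).toBelow rfl)
          (ih _ (JTerm.Sub.gapp₂ _ _ _).toBelow rfl)
    · exact .lam (ih _ (JTerm.Sub.lam _).toBelow rfl)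
    · obtain ⟨N, c, hs, hstep, hN⟩ := h.toJ
      exact h.sn (hs.sn (ih _ hstep.toBelow rfl) (ih _ hN rfl))
    · obtain ⟨hstep, hN⟩ := h.toJ
      exact h.sn (ih _ hstep.toBelow rfl) (ih _ hN rfl)

/-! ### Accessibility for reduction and the subterm relation -/

/-- `Sub P M`: `P` is an immediate subterm of `M`. -/
inductive Sub : ESTerm → ESTerm → Prop
  | lam (M : ESTerm) : Sub M (lam M)
  | app₁ (M N : ESTerm) : Sub M (app M N)
  | app₂ (M N : ESTerm) : Sub N (app M N)
  | esub₁ (M N : ESTerm) : Sub M (esub M N)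
  | esub₂ (M N : ESTerm) : Sub N (esub M N)

theorem Sub.wellFounded : WellFounded Sub := by
  refine ⟨fun M => ?_⟩
  induction M with
  | var x => exact ⟨_, fun _ h => nomatch h⟩
  | lam M ih => exact ⟨_, fun _ h => by cases h; exact ih⟩
  | app M N ihM ihN => exact ⟨_, fun _ h => by cases h <;> assumption⟩
  | esub M N ihM ihN => exact ⟨_, fun _ h => by cases h <;> assumption⟩

/-- `Below b a`: `b` is obtained from `a` by reduction steps and passages to a subterm, at least
one in total. -/
def Below : ESTerm → ESTerm → Prop := Relation.TransGen fun b a => Step a b ∨ Sub b a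

theorem Below.trans {a b c : ESTerm} (h : Below a b) (h' : Below b c) : Below a c :=
  Relation.TransGen.trans h h'

theorem Step.toBelow {a b : ESTerm} (h : Step a b) : Below b a := .single (.inl h)

theorem Sub.toBelow {a b : ESTerm} (h : Sub b a) : Below b a := .single (.inr h)

theorem Step.below_of_steps {a b c : ESTerm} (h : Step a b) (h' : Steps b c) : Below c a := by
  induction h' with
  | refl => exact h.toBelow
  | tail _ h₁ ih => exact h₁.toBelow.trans ih

theorem SN.acc_below {M : ESTerm} (h : SN M) : Acc Below M := by
  refine Acc.transGen (StronglyNormalizing.acc_union Sub.wellFounded ?_ h)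
  intro s t s' hst hs
  cases hst with
  | lam => exact ⟨_, hs.lam, .lam _⟩
  | app₁ => exact ⟨_, hs.app₁ _, .app₁ _ _⟩
  | app₂ => exact ⟨_, hs.app₂ _, .app₂ _ _⟩
  | esub₁ => exact ⟨_, hs.esub₁ _, .esub₁ _ _⟩
  | esub₂ => exact ⟨_, hs.esub₂ _, .esub₂ _ _⟩

theorem steps_app_lam (M N : ESTerm) : Steps (app (lam M) N) (inst M N) := by
  have h := Step.dB [] M N
  simp only [plug, List.length_nil, Nat.add_zero, rename_id] at h
  exact .tail (.single h) (.sub M N)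

theorem inst_subst_splitVar (R p q : ESTerm) :
    inst (inst (subst splitVar R) (shift q)) p = inst R (app p q) := by
  simp only [inst, subst_subst]
  congr 1; funext n; rcases n with _ | n
  · exact congrArg (app p) (inst_shift q p)
  · rfl

/-- The translation of a generalized argument, as a term with one hole of index `0`. -/
def argBody (S : JTerm × JTerm) : ESTerm :=
  esub (subst splitVar S.2.toES) (shift S.1.toES)

/-- The translation of `t S₁ … Sₙ` under a substitution, in terms of that of `t`. -/
def esubs (σ : ℕ → ESTerm) (M : ESTerm) (Ss : List (JTerm × JTerm)) : ESTerm :=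
  Ss.foldl (fun M S => esub (subst (up σ) (argBody S)) M) M

theorem subst_toES_appArgs (σ : ℕ → ESTerm) (t : JTerm) (Ss : List (JTerm × JTerm)) :
    subst σ (JTerm.appArgs t Ss).toES = esubs σ (subst σ t.toES) Ss := by
  induction Ss generalizing t with
  | nil => rfl
  | cons S Ss ih => exact ih (JTerm.appArg t S)

theorem argBody_shiftArg (S : JTerm × JTerm) :
    argBody (JTerm.shiftArg S) = rename (upRen Nat.succ) (argBody S) := by
  simp only [argBody, JTerm.shiftArg, JTerm.shift, JTerm.toES_rename, rename, shift,
    rename_rename, subst_rename, rename_subst]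
  congr 2
  funext n; cases n <;> rfl

/-- Weakened arguments do not see index `0`. This identifies the translation of `r` applied to
weakened arguments with a reduct of the translation of `x(u,y.r)` applied to the original ones. -/
theorem esubs_map_shiftArg (σ : ℕ → ESTerm) (M : ESTerm) (Ss : List (JTerm × JTerm)) :
    esubs σ M (Ss.map JTerm.shiftArg) = esubs (σ ∘ Nat.succ) M Ss := by
  induction Ss generalizing M with
  | nil => rfl
  | cons S Ss ih =>
    have : subst (up σ) (argBody (JTerm.shiftArg S)) = subst (up (σ ∘ Nat.succ)) (argBody S) := by
      rw [argBody_shiftArg, subst_rename]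
      congr 1; funext n; cases n <;> rfl
    simp only [esubs, List.map_cons, List.foldl_cons, this]
    exact ih _

theorem Step.esubs {M M' : ESTerm} (h : Step M M') (σ : ℕ → ESTerm)
    (Ss : List (JTerm × JTerm)) : Step (ESTerm.esubs σ M Ss) (ESTerm.esubs σ M' Ss) := by
  induction Ss generalizing M M' with
  | nil => exact h
  | cons S Ss ih => exact ih (h.esub₂ _)

theorem Steps.esubs {M M' : ESTerm} (h : Steps M M') (σ : ℕ → ESTerm)
    (Ss : List (JTerm × JTerm)) : Steps (ESTerm.esubs σ M Ss) (ESTerm.esubs σ M' Ss) :=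
  h.lift (fun M => ESTerm.esubs σ M Ss) fun _ _ h => h.esubs σ Ss

theorem Below.esubs {P M : ESTerm} (h : Below P M) (σ : ℕ → ESTerm)
    (Ss : List (JTerm × JTerm)) : Below P (ESTerm.esubs σ M Ss) := by
  induction Ss generalizing M with
  | nil => exact h
  | cons S Ss ih => exact ih (h.trans (Sub.esub₂ _ _).toBelow)

/-- The substitution `σ` extended by `M` for index `0`. -/
def scons (M : ESTerm) (σ : ℕ → ESTerm) : ℕ → ESTerm
  | 0 => M
  | n + 1 => σ n

theorem inst_subst_up (σ : ℕ → ESTerm) (M N : ESTerm) :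
    inst (subst (up σ) M) N = subst (scons N σ) M := by
  rw [inst, subst_subst]
  congr 1; funext n; cases n
  · rfl
  · exact inst_shift _ _

/-- Contraction of the two explicit substitutions that translate a generalized argument. -/
theorem exists_esub_argBody_step (σ : ℕ → ESTerm) (M : ESTerm) (u r : JTerm) :
    ∃ P, Step (esub (subst (up σ) (argBody (u, r))) M) P ∧
      Steps P (subst (scons (app M (subst σ u.toES)) σ) r.toES) := by
  have h₁ : subst (up σ) (argBody (u, r)) =
      esub (subst splitVar (subst (up σ) r.toES)) (shift (subst σ u.toES)) := by
    simp only [argBody, subst, JTerm.splitVar_subst_up, subst_up_shift]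
  rw [h₁]
  refine ⟨_, .esub₁ _ (.sub _ _), .single ?_⟩
  convert Step.sub _ _ using 1
  rw [inst_subst_splitVar, inst_subst_up]

/-! ### Strong normalization is reflected by the translation into explicit substitutions -/

/-- The substitution `σ` makes the induction go through: executing the substitutions of a
generalized argument replaces the bound variable of `r` by an ES application, and the result is
handled as an instance of the translation of `r`, with a larger `σ`. -/
theorem SN.of_subst_toES {t : JTerm} {σ : ℕ → ESTerm} (h : SN (subst σ t.toES)) :
    JTerm.SN t := by
  have hacc := h.acc_below
  clear h
  generalize hc : subst σ t.toES = c at hacc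
  induction hacc generalizing t σ with
  | intro c _ ih =>
    subst hc
    have arg (t u r : JTerm) (Ss : List (JTerm × JTerm)) :
        Below (subst (up σ) (shift u.toES))
          (subst σ (JTerm.appArgs (JTerm.gapp t u r) Ss).toES) := by
      rw [subst_toES_appArgs]
      exact ((Sub.esub₂ _ _).toBelow.trans (Sub.esub₁ _ _).toBelow).esubs _ _
    have arg_sn {t u r : JTerm} {Ss : List (JTerm × JTerm)}
        (ih : ∀ y, Below y (subst σ (JTerm.appArgs (JTerm.gapp t u r) Ss).toES) →
          ∀ {t : JTerm} {σ : ℕ → ESTerm}, subst σ t.toES = y → JTerm.SN t) : JTerm.SN u :=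
      -- The weakening of `u` is absorbed into the substitution, so the hypothesis applies to `u`
      -- itself.
      ih _ (arg t u r Ss) (subst_rename Nat.succ (up σ) u.toES).symm
    obtain ⟨h, Ss, rfl, ⟨x, rfl⟩ | ⟨t, rfl⟩⟩ := JTerm.exists_appArgs t
    · match Ss with
      | [] => exact .var x
      | (u, r) :: Ss =>
        -- All arguments after the first are pushed by π into `r`. The resulting body, with its
        -- index `0` sent to `σ x` applied to the image of `u`, translates to a proper reduct of the
        -- given term.
        refine JTerm.SN.pi_expansions (JTerm.SN.gapp_var x (arg_sn ih) ?_)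
        obtain ⟨P, hP, hP'⟩ := exists_esub_argBody_step σ (σ x) u r
        refine ih _ ?_ rfl (σ := scons (app (σ x) (subst σ u.toES)) σ)
        rw [subst_toES_appArgs, esubs_map_shiftArg, subst_toES_appArgs]
        exact (hP.esubs σ Ss).below_of_steps (hP'.esubs σ Ss)
    · match Ss with
      | [] => exact .lam (ih _ (Sub.lam _).toBelow rfl)
      | (u, r) :: Ss =>
        refine JTerm.SN.beta_expansion (ih _ ?_ rfl (σ := σ)) (ih _ ?_ rfl (σ := up σ))
          (arg_sn ih)
        · obtain ⟨P, hP, hP'⟩ := exists_esub_argBody_step σ (subst σ t.lam.toES) u r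
          rw [subst_toES_appArgs, subst_toES_appArgs, JTerm.toES_inst, JTerm.toES_inst, subst_inst,
            subst_inst, inst_subst_up]
          -- The abstraction applied to `u` is contracted in each of its copies in `r`. There may be
          -- none, so strict decrease comes from the initial step `hP`.
          refine (hP.esubs σ Ss).below_of_steps (Steps.esubs (hP'.trans (Steps.subst ?_ _)) σ Ss)
          rintro (_ | x)
          · exact steps_app_lam _ _
          · exact .refl
        · rw [subst_toES_appArgs]
          exact ((Sub.lam _).toBelow.trans (Sub.esub₂ _ _).toBelow).esubs _ _

end ESTerm

theorem mainTheorem8 :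
    (∀ t : JTerm, JTerm.SN t → JTerm.ISN (JTerm.toJJ t)) ∧
    (∀ t : JTerm, JTerm.SN t ↔ ESTerm.SN (JTerm.toES t)) := by
  refine ⟨fun t h => h.toJJ.isn, fun t => ⟨fun h => ESTerm.SN.of_toJ h.toJJ, fun h => ?_⟩⟩
  refine ESTerm.SN.of_subst_toES (σ := ESTerm.var) ?_
  rwa [ESTerm.subst_var]
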